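/- **Queries.** A full conjunctive query $q(x_1,\dots,x_k)$ is a finite set of atoms $S(x_{i_1},\dots,x_{i_a})$ over a relational vocabulary, such that each of $x_1,\dots,x_k$ occurs in some atom. Let $\tau^*(q)\in[0,\infty]$ be its fractional vertex covering number, i.e. the infimum of $\sum_x v_x$ over all $v\ge 0$ with $\sum_{x\in \mathrm{vars}(A)}v_x\ge 1$ for every atom $A$ of $q$. The query is connected if its hypergraph (nodes: variables, hyperedges: variable sets of atoms) is connected. Let $0\le\varepsilon<1$. Put $\Gamma^1_\varepsilon=\{q:\tau^*(q)\le 1/(1-\varepsilon)\}$. For $r>1$, $\Gamma^r_\varepsilon$ consists of all queries $q=q_0[q_1/V_1,\dots,q_m/V_m]$, where $q_1,\dots,q_m\in\Gamma^{r-1}_\varepsilon$ are connected, $q_0\in\Gamma^1_\varepsilon$ is a query over the vocabulary $V_1,\dots,V_m$ with $\mathrm{arity}(V_j)=|\mathrm{vars}(q_j)|$, and $q$ arises from $q_0$ by replacing each atom $V_j(\bar y)$ with the atoms of $q_j(\bar y)$. **Data.** A database over the domain $[n]$ is a matching database if in every column of every relation each value occurs at most once. A relation of arity $a$ with $m$ tuples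 has size $a\,m\log_2 n$ bits. **Model.** In the MPC model there are $p$ servers. The input tuples are placed, each on exactly one of a finite family of input servers (for instance, one input server for each relation). In round 1 every input server sends each of the $p$ servers a bit string depending on the data it stores; in each later round every server sends each server a bit string depending on all that it has received so far. After $r$ rounds each server reports a set of tuples as a function of all that it has received, and the output is the union of these sets. Local computation is unrestricted, and a finite number of uniform random bits, independent of the input, is available to everybody. The load is the maximum number of bits received by a server in a round. **Proposition.** Let $0\le\varepsilon<1$, $r\ge1$ and $q\in\Gamma^r_\varepsilon$. For all $\eta>0$ and $\kappa\in\mathbb N$ there is a constant $C>0$ such that for all $p\ge1$, $n\ge2$ and real $M\ge p^{1-\varepsilon}\log_2 p\,\log_2 n$, and every finite family of input servers, there is a randomized MPC algorithm with the following property: for every matching database $I$ over $[n]$ all of whose relations have size at most $M$, and every placement of its tuples on the input servers, with probability at least $1-\eta/p^{\kappa}$ the algorithm outputs exactly $q(I)$ after $r$ rounds with load at most $C\cdot M/p^{1-\varepsilon}$ in each of these rounds. -/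

import Mathlib

/-! ### Conjunctive queries -/

/-- An atom `S(x₁, …, xₐ)` over a vocabulary `σ` with arities `ar`, in variables `Fin k`. -/
structure Atom {σ : Type*} (ar : σ → ℕ) (k : ℕ) where
  rel : σ
  args : Fin (ar rel) → Fin k

namespace Atom

variable {σ : Type*} {ar : σ → ℕ} {k : ℕ}

/-- The set of variables that occur in an atom. -/
def vars (A : Atom ar k) : Finset (Fin k) := Finset.univ.image A.args

/-- Rename the variables of an atom. -/
def rename {l : ℕ} (f : Fin k → Fin l) (A : Atom ar k) : Atom ar l := ⟨A.rel, f ∘ A.args⟩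

end Atom

/-- A full conjunctive query `q(x₁, …, xₖ)`: a finite set of atoms such that every variable occurs
in some atom (every variable is a head variable, and the head is `(x₁, …, xₖ)`). -/
structure ConjQuery {σ : Type*} (ar : σ → ℕ) (k : ℕ) where
  atoms : Finset (Atom ar k)
  full : ∀ x : Fin k, ∃ A ∈ atoms, x ∈ A.vars

/-- A database instance over the domain `[n]`: a finite relation for every relation symbol. -/
abbrev Database {σ : Type*} (ar : σ → ℕ) (n : ℕ) : Type _ :=
  (S : σ) → Finset (Fin (ar S) → Fin n)

namespace Database

variable {σ : Type*} {ar : σ → ℕ} {n : ℕ}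

/-- Matching database: every value occurring in a column of a relation occurs there exactly once. -/
def IsMatching (I : Database ar n) : Prop :=
  ∀ S : σ, ∀ t ∈ I S, ∀ t' ∈ I S, ∀ i, t i = t' i → t = t'

/-- The size in bits of the relation `S`: arity times cardinality times `log₂ n`. -/
noncomputable def relSize (I : Database ar n) (S : σ) : ℝ :=
  (ar S : ℝ) * ((I S).card : ℝ) * Real.logb 2 n

open Classical in
/-- The part of the database stored on input server `w`, when the tuple `t` of the relation `S`
is placed on the input server `loc S t`. -/
noncomputable def fragment {W : Type*} (I : Database ar n)
    (loc : (S : σ) → (Fin (ar S) → Fin n) → W) (w : W) : Database ar n :=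
  fun S => (I S).filter (fun t => loc S t = w)

end Database

namespace ConjQuery

variable {σ : Type*} {ar : σ → ℕ} {k : ℕ}

/-- The answer `q(I)`. -/
def eval {n : ℕ} (q : ConjQuery ar k) (I : Database ar n) : Set (Fin k → Fin n) :=
  {t | ∀ A ∈ q.atoms, t ∘ A.args ∈ I A.rel}

/-- Fractional vertex covers of the hypergraph of `q`. -/
def IsFractionalVertexCover (q : ConjQuery ar k) (v : Fin k → NNReal) : Prop :=
  ∀ A ∈ q.atoms, 1 ≤ ∑ x ∈ A.vars, v x

/-- The fractional vertex covering number `τ*(q)`; it is `⊤` if there is no fractional vertex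
cover, that is, if `q` has an atom without variables. -/
noncomputable def tauStar (q : ConjQuery ar k) : ENNReal :=
  ⨅ (v : Fin k → NNReal) (_ : q.IsFractionalVertexCover v), ((∑ x, v x : NNReal) : ENNReal)

/-- The hypergraph of `q` is connected: any two variables are joined by a chain of atoms, each
sharing a variable with the next. -/
def Connected (q : ConjQuery ar k) : Prop :=
  (SimpleGraph.fromRel (fun x y : Fin k => ∃ A ∈ q.atoms, x ∈ A.vars ∧ y ∈ A.vars)).Preconnected

/-- `q = q₀[q₁/V₁, …, qₘ/Vₘ]`: the atoms of `q` are obtained by replacing every atom `Vⱼ(y₁, …, yₐ)`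
of `q₀` by the atoms of `qⱼ(x₁, …, xₐ)` with `yᵢ` for `xᵢ`. The view `Vⱼ` has arity `|vars(qⱼ)|`. -/
def IsSubstitution {m : ℕ} {a : Fin m → ℕ} (q : ConjQuery ar k) (q₀ : ConjQuery a k)
    (qs : (j : Fin m) → ConjQuery ar (a j)) : Prop :=
  ∀ A : Atom ar k,
    A ∈ q.atoms ↔ ∃ B ∈ q₀.atoms, ∃ A' ∈ (qs B.rel).atoms, A = A'.rename B.args

/-- `q ∈ Γ¹_ε`. -/
def InGammaOne (ε : ℝ) (q : ConjQuery ar k) : Prop :=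
  q.tauStar ≤ ENNReal.ofReal (1 / (1 - ε))

/-- `q ∈ Γʳ_ε`, for `r ≥ 1`: `q` has a query plan of depth `r` with operators in `Γ¹_ε`, whose
intermediate views are connected queries. -/
def InGamma {σ : Type*} {ar : σ → ℕ} (ε : ℝ) : (r : ℕ) → {k : ℕ} → ConjQuery ar k → Prop
  | 0, _, _ => False
  | 1, _, q => q.InGammaOne ε
  | r + 2, k, q =>
    ∃ (m : ℕ) (a : Fin m → ℕ) (qs : (j : Fin m) → ConjQuery ar (a j)) (q₀ : ConjQuery a k),
      (∀ j, (qs j).Connected ∧ InGamma ε (r + 1) (qs j)) ∧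
        q₀.InGammaOne ε ∧ q.IsSubstitution q₀ qs

end ConjQuery

/-! ### The MPC model -/

/-- Everything that a server has received so far: in the first round a message (bit string) from
every input server `w : W`, and in every later round (latest round first) a message from each of
the `p` servers. -/
structure History (W : Type*) (p : ℕ) where
  first : W → List Bool
  later : List (Fin p → List Bool)

/-- A deterministic algorithm in the MPC model with `p` servers, for inputs over the domain `[n]`
stored on the input servers `W`, reporting tuples in `[n]ᵏ`. Local computation is unrestricted. -/
structure MPCAlgorithm {σ : Type*} (ar : σ → ℕ) (W : Type*) (n p k : ℕ) where
  /-- The first-round message from an input server, given the data it stores, to a server. -/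
  input : W → Database ar n → Fin p → List Bool
  /-- The message from a server, given what it has received in all previous rounds, to a server. -/
  send : Fin p → History W p → Fin p → List Bool
  /-- The tuples that a server reports at the end, given all that it has received. -/
  output : Fin p → History W p → Set (Fin k → Fin n)

namespace MPCAlgorithm

variable {σ : Type*} {ar : σ → ℕ} {W : Type*} {n p k : ℕ}

/-- What each server has received in the first `i` rounds, if input server `w` stores `D w`. -/
def history (A : MPCAlgorithm ar W n p k) (D : W → Database ar n) : ℕ → Fin p → History W p
  | 0, _ => ⟨fun _ => [], []⟩
  | 1, s => ⟨fun w => A.input w (D w) s, []⟩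
  | i + 2, s =>
    ⟨(A.history D (i + 1) s).first,
      (fun s' => A.send s' (A.history D (i + 1) s') s) :: (A.history D (i + 1) s).later⟩

/-- The load of server `s` in round `i` (rounds are `1, 2, …`): the number of bits received. -/
def load [Fintype W] (A : MPCAlgorithm ar W n p k) (D : W → Database ar n) : ℕ → Fin p → ℕ
  | 0, _ => 0
  | 1, s => ∑ w, (A.input w (D w) s).length
  | i + 2, s => ∑ s', (A.send s' (A.history D (i + 1) s') s).length

/-- On the given input, `A` reports exactly the set `T` after `r` rounds, and no server receives
more than `L` bits in any of these rounds. -/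
def Computes [Fintype W] (A : MPCAlgorithm ar W n p k) (D : W → Database ar n) (r : ℕ) (L : ℝ)
    (T : Set (Fin k → Fin n)) : Prop :=
  (⋃ s, A.output s (A.history D r s)) = T ∧
    ∀ i, 1 ≤ i → i ≤ r → ∀ s, (A.load D i s : ℝ) ≤ L

end MPCAlgorithm

/-- A randomized MPC algorithm: a deterministic one for every outcome of finitely many independent
uniform random bits, which are available to all servers. -/
structure RandomizedMPCAlgorithm {σ : Type*} (ar : σ → ℕ) (W : Type*) (n p k : ℕ) where
  numBits : ℕ
  alg : (Fin numBits → Bool) → MPCAlgorithm ar W n p k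

open Classical in
/-- The probability, over the random bits, that the algorithm does not report exactly `T` in `r`
rounds with maximum load at most `L`. -/
noncomputable def RandomizedMPCAlgorithm.failureProb {σ : Type*} {ar : σ → ℕ} {W : Type*}
    [Fintype W] {n p k : ℕ} (A : RandomizedMPCAlgorithm ar W n p k) (D : W → Database ar n)
    (r : ℕ) (L : ℝ) (T : Set (Fin k → Fin n)) : ℝ :=
  ((Finset.univ.filter fun ω => ¬ (A.alg ω).Computes D r L T).card : ℝ) / 2 ^ A.numBits

/-! ### Codes -/

/-! One round is the HyperCube algorithm. A fractional vertex cover `v` of weight at most 1/(1-ε)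
gives each value of the variable `x` about (1-ε) · v x · log₂ p random hash bits. There are then
enough servers for all hash vectors, and a tuple of an atom is relevant to a given server with
probability at most 2^k / p^(1-ε) (`exists_shares`). Distinct tuples of a matching differ in every
column, so their relevance is decided by disjoint sets of bits, and `choose_mul_pow_le` gives a
Chernoff bound: more than a large constant times μ = M / (p^(1-ε) log₂ n) relevant tuples are
exponentially unlikely in μ. As μ ≥ log₂ p, the union bound over servers and atoms beats any power
of p (`InGammaOne.hasProtocol`).

More rounds follow by induction. By connectedness the views of a matching database again form a
matching database, larger by at most a constant factor (`views_isMatching`, `relSize_views_le`). So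
they can be computed in parallel and then fed into one HyperCube round (`HasProtocol.substitution`).

All rounds share the same random bits, so the placement of the views on the servers is correlated
with the hashing of the last round. `HasProtocol` is strengthened for this reason: the HyperCube
load does not depend on the placement, so neither does the bad event; and every answer has a single
owner, so each view tuple is stored exactly once. -/

theorem List.flatMap_ofFn_injective {F : Type*} {ℓ : ℕ} (hℓ : 1 ≤ ℓ) {f : F → Fin ℓ → Bool}
    (hf : Function.Injective f) :
    Function.Injective fun l : List F => l.flatMap fun a => List.ofFn (f a) := by
  intro l
  induction l with
  | nil =>
    intro l' h
    cases l' with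
    | nil => rfl
    | cons b l' =>
      have := congrArg List.length h
      simp at this
      omega
  | cons a l ih =>
    intro l' h
    cases l' with
    | nil =>
      have := congrArg List.length h
      simp at this
      omega
    | cons b l' =>
      simp only [List.flatMap_cons] at h
      obtain ⟨h₁, h₂⟩ := List.append_inj h (by simp)
      rw [hf (List.ofFn_injective h₁), ih h₂]

/-- Lists over a finite alphabet with at most `2 ^ ℓ` letters can be coded with `ℓ` bits per
letter. -/
theorem exists_list_code (F : Type*) [Fintype F] {ℓ : ℕ} (hℓ : 1 ≤ ℓ)
    (h : Fintype.card F ≤ 2 ^ ℓ) :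
    ∃ enc : List F → List Bool, Function.Injective enc ∧
      ∀ l, (enc l).length = ℓ * l.length := by
  obtain ⟨f⟩ : Nonempty (F ↪ (Fin ℓ → Bool)) :=
    Function.Embedding.nonempty_of_card_le (by simpa using h)
  refine ⟨_, List.flatMap_ofFn_injective hℓ f.injective, fun l => ?_⟩
  simp [List.length_flatMap, mul_comm]

theorem exists_finset_code (F : Type*) [Fintype F] {ℓ : ℕ} (hℓ : 1 ≤ ℓ)
    (h : Fintype.card F ≤ 2 ^ ℓ) :
    ∃ enc : Finset F → List Bool, Function.Injective enc ∧
      ∀ s, (enc s).length = ℓ * s.card := by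
  obtain ⟨enc, hi, hl⟩ := exists_list_code F hℓ h
  refine ⟨fun s => enc s.toList, fun s t hst => ?_, fun s => by simp [hl]⟩
  classical
  rw [← s.toList_toFinset, hi hst, t.toList_toFinset]

theorem filterMap_flatMap_tag {J : Type*} [DecidableEq J] (l : J → List Bool) (j : J)
    (L : List J) (hL : L.Nodup) :
    (L.flatMap fun i => (l i).map (Prod.mk i)).filterMap
      (fun x => if x.1 = j then some x.2 else none) = if j ∈ L then l j else [] := by
  induction L with
  | nil => simp
  | cons i L ih =>
    rw [List.nodup_cons] at hL
    rw [List.flatMap_cons, List.filterMap_append, ih hL.2, List.filterMap_map]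
    by_cases hij : i = j
    · subst hij
      simp [hL.1]
    · simp [hij, Ne.symm hij]

/-- Several messages can be packed into one, whose length is proportional to the total length. -/
theorem exists_pack (m : ℕ) :
    ∃ ℓ : ℕ, ∃ pack : (Fin m → List Bool) → List Bool, Function.Injective pack ∧
      ∀ l, (pack l).length = ℓ * ∑ j, (l j).length := by
  -- Each bit is tagged with the index of its message. There is no header, so empty messages cost
  -- nothing; this matters because the load sums over all senders.
  obtain ⟨enc, hi, hl⟩ := exists_list_code (Fin m × Bool) (ℓ := m * 2 + 1) (by omega)
    (by simpa using Nat.le_of_lt ((Nat.lt_succ_self _).trans (Nat.lt_two_pow_self)))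
  refine ⟨m * 2 + 1, fun l => enc ((List.finRange m).flatMap fun i => (l i).map (Prod.mk i)),
    fun l l' h => ?_, fun l => ?_⟩
  · funext j
    have := congrArg (List.filterMap fun x => if x.1 = j then some x.2 else none) (hi h)
    rw [filterMap_flatMap_tag l j _ (List.nodup_finRange m),
      filterMap_flatMap_tag l' j _ (List.nodup_finRange m)] at this
    simpa using this
  · rw [hl]
    simp [List.length_flatMap, ← List.ofFn_eq_map, List.sum_ofFn]

/-! ### Counting bit strings -/

/-- Prescribing the bits at distinct positions divides the number of bit strings accordingly. -/
theorem card_filter_prescribed_mul {Y : Type*} {N : ℕ} (g : Y ↪ Fin N) (J : Finset Y)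
    (val : Y → Bool) [DecidablePred fun ω : Fin N → Bool => ∀ y ∈ J, ω (g y) = val y] :
    (Finset.univ.filter fun ω : Fin N → Bool => ∀ y ∈ J, ω (g y) = val y).card * 2 ^ J.card
      ≤ 2 ^ N := by
  classical
  have hsub : (Finset.univ.filter fun ω : Fin N → Bool => ∀ y ∈ J, ω (g y) = val y) ⊆
      Fintype.piFinset fun i : Fin N =>
        if h : ∃ y ∈ J, g y = i then {val h.choose} else Finset.univ := by
    intro ω hω
    rw [Fintype.mem_piFinset]
    intro i
    split_ifs with h
    · have := (Finset.mem_filter.1 hω).2 _ h.choose_spec.1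
      rw [h.choose_spec.2] at this
      simpa using this
    · simp
  have hcard := Finset.card_le_card hsub
  rw [Fintype.card_piFinset] at hcard
  refine (Nat.mul_le_mul_right _ hcard).trans (le_of_eq ?_)
  have h2 : ∀ i : Fin N, (if h : ∃ y ∈ J, g y = i then ({val h.choose} : Finset Bool)
      else Finset.univ).card = if i ∈ J.map g then 1 else 2 := by
    intro i
    have : (i ∈ J.map g) ↔ ∃ y ∈ J, g y = i := by simp
    by_cases h : ∃ y ∈ J, g y = i
    · rw [dif_pos h, if_pos (this.2 h)]; simp
    · rw [dif_neg h, if_neg (fun h' => h (this.1 h'))]; simp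
  have h3 : 2 ^ J.card = ∏ i : Fin N, if i ∈ J.map g then 2 else 1 := by
    rw [Finset.prod_ite_mem, Finset.univ_inter, Finset.prod_const, Finset.card_map]
  rw [h3, ← Finset.prod_mul_distrib]
  simp_rw [h2]
  rw [Finset.prod_congr rfl (g := fun _ => 2) fun i _ => by split_ifs <;> rfl]
  simp

/-- The union bound over the `T`-subsets: at least `T` of the events `E t`, `t ∈ R`, occur with
probability at most `(|R| choose T) δ ^ T` if any `T` of them occur together with probability at
most `δ ^ T`. -/
theorem card_filter_le_choose_mul {Ω τ : Type*} [Fintype Ω] (R : Finset τ) (E : τ → Ω → Prop)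
    (T : ℕ) (B : ℝ) [∀ ω, DecidablePred fun t => E t ω]
    [DecidablePred fun ω => T ≤ (R.filter fun t => E t ω).card]
    [∀ S : Finset τ, DecidablePred fun ω => ∀ t ∈ S, E t ω]
    (h : ∀ S ⊆ R, S.card = T → ((Finset.univ.filter fun ω => ∀ t ∈ S, E t ω).card : ℝ) ≤ B) :
    ((Finset.univ.filter fun ω => T ≤ (R.filter fun t => E t ω).card).card : ℝ)
      ≤ R.card.choose T * B := by
  classical
  have hsub : (Finset.univ.filter fun ω => T ≤ (R.filter fun t => E t ω).card) ⊆
      (R.powersetCard T).biUnion fun S => Finset.univ.filter fun ω => ∀ t ∈ S, E t ω := by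
    intro ω hω
    obtain ⟨S, hS, hST⟩ := Finset.exists_subset_card_eq (Finset.mem_filter.1 hω).2
    simp only [Finset.mem_biUnion, Finset.mem_powersetCard]
    refine ⟨S, ⟨hS.trans (Finset.filter_subset _ _), hST⟩, ?_⟩
    simp only [Finset.mem_filter, Finset.mem_univ, true_and]
    exact fun t ht => (Finset.mem_filter.1 (hS ht)).2
  calc _ ≤ (((R.powersetCard T).biUnion fun S =>
        Finset.univ.filter fun ω => ∀ t ∈ S, E t ω).card : ℝ) := by
        exact_mod_cast Finset.card_le_card hsub
    _ ≤ ∑ S ∈ R.powersetCard T, ((Finset.univ.filter fun ω => ∀ t ∈ S, E t ω).card : ℝ) := by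
        exact_mod_cast Finset.card_biUnion_le
    _ ≤ ∑ S ∈ R.powersetCard T, B := Finset.sum_le_sum fun S hS =>
        h S (Finset.mem_powersetCard.1 hS).1 (Finset.mem_powersetCard.1 hS).2
    _ = _ := by simp

/-- A Chernoff bound in terms of binomial coefficients. -/
theorem choose_mul_pow_le {m T : ℕ} {δ : ℝ} (hδ : 0 ≤ δ) (h : 6 * (m * δ) ≤ T) :
    (m.choose T : ℝ) * δ ^ T ≤ (1 / 2) ^ T := by
  have hT : (0 : ℝ) < T.factorial := by exact_mod_cast T.factorial_pos
  have h0 : (0 : ℝ) ≤ m * δ := by positivity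
  calc (m.choose T : ℝ) * δ ^ T ≤ (m : ℝ) ^ T / T.factorial * δ ^ T := by
        gcongr; exact Nat.choose_le_pow_div T m
    _ = (m * δ) ^ T / T.factorial := by rw [mul_pow]; ring
    _ ≤ (T / 6 : ℝ) ^ T / T.factorial := by gcongr; linarith
    _ = (1 / 6) ^ T * ((T : ℝ) ^ T / T.factorial) := by rw [div_pow, div_pow]; ring
    _ ≤ (1 / 6) ^ T * Real.exp T := by
        gcongr; exact Real.pow_div_factorial_le_exp _ (Nat.cast_nonneg T) T
    _ = (1 / 6 * Real.exp 1) ^ T := by rw [mul_pow, ← Real.exp_nat_mul, mul_one]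
    _ ≤ (1 / 2) ^ T := by
        -- The factor 6 in the hypothesis is there for e / 6 ≤ 1 / 2.
        have := Real.exp_one_lt_d9
        gcongr; linarith

/-! ### Shares -/

namespace ConjQuery

variable {σ : Type*} {ar : σ → ℕ} {k : ℕ}

/-- The infimum in the definition of `τ*` is attained. -/
theorem exists_cover_of_tauStar_le {q : ConjQuery ar k} {c : ℝ} (hc : 0 ≤ c)
    (h : q.tauStar ≤ ENNReal.ofReal c) :
    ∃ v, q.IsFractionalVertexCover v ∧ ∑ x, (v x : ℝ) ≤ c := by
  lift c to NNReal using hc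
  rw [ENNReal.ofReal_coe_nnreal] at h
  -- The cutoff c + 1 makes the set of covers compact; it stays nonempty because the infimum is
  -- below c + 1, and covers outside it cannot beat the minimum.
  set K : Set (Fin k → NNReal) := {v | q.IsFractionalVertexCover v ∧ ∑ x, v x ≤ c + 1} with hK
  have hclosed : IsClosed K := by
    have : K = (⋂ A ∈ q.atoms, {v | 1 ≤ ∑ x ∈ A.vars, v x}) ∩ {v | ∑ x, v x ≤ c + 1} := by
      ext v
      simp [hK, IsFractionalVertexCover]
    rw [this]
    refine (isClosed_biInter fun A _ => isClosed_le continuous_const ?_).inter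
      (isClosed_le ?_ continuous_const) <;> fun_prop
  have hcompact : IsCompact K := by
    refine (isCompact_Icc (a := (0 : Fin k → NNReal)) (b := fun _ => c + 1)).of_isClosed_subset
      hclosed fun v hv => ⟨fun _ => zero_le, fun x => ?_⟩
    exact (Finset.single_le_sum (fun _ _ => zero_le) (Finset.mem_univ x)).trans hv.2
  have hne : K.Nonempty := by
    have hlt : q.tauStar < ((c + 1 : NNReal) : ENNReal) :=
      h.trans_lt (by exact_mod_cast lt_add_one c)
    rw [tauStar, iInf_lt_iff] at hlt
    obtain ⟨v, hv⟩ := hlt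
    rw [iInf_lt_iff] at hv
    obtain ⟨hv, hlt⟩ := hv
    exact ⟨v, hv, by exact_mod_cast hlt.le⟩
  obtain ⟨v, hv, hmin⟩ := hcompact.exists_isMinOn hne
    (f := fun v : Fin k → NNReal => ∑ x, v x) (by fun_prop)
  refine ⟨v, hv.1, ?_⟩
  have hle : ((∑ x, v x : NNReal) : ENNReal) ≤ q.tauStar := by
    refine le_iInf₂ fun w hw => ?_
    rw [ENNReal.coe_le_coe]
    by_cases hwK : ∑ x, w x ≤ c + 1
    · exact hmin ⟨hw, hwK⟩
    · exact hv.2.trans (not_le.1 hwK).le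
  have := hle.trans h
  rw [ENNReal.coe_le_coe] at this
  exact_mod_cast this

/-- Shares for the HyperCube algorithm, rounded to powers of two. -/
theorem exists_shares {q : ConjQuery ar k} {ε : ℝ} (hε₁ : ε < 1) (hq : q.InGammaOne ε) {p : ℕ}
    (hp : 1 ≤ p) :
    ∃ b : Fin k → ℕ, 2 ^ (∑ x, b x) ≤ p ∧
      ∀ A ∈ q.atoms, (p : ℝ) ^ (1 - ε) ≤ 2 ^ k * 2 ^ (∑ x ∈ A.vars, b x) := by
  have hδ : 0 < 1 - ε := by linarith
  obtain ⟨v, hv, hsum⟩ := exists_cover_of_tauStar_le (by positivity) hq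
  have hp0 : (0 : ℝ) < p := by exact_mod_cast hp
  set L := Real.logb 2 p with hL
  have hL0 : 0 ≤ L := Real.logb_nonneg one_lt_two (by exact_mod_cast hp)
  have hpow : (2 : ℝ) ^ L = p := Real.rpow_logb two_pos (by norm_num) hp0
  -- Rounding down keeps the number of servers at most p. It loses less than one bit per variable,
  -- hence the factor 2^k.
  refine ⟨fun x => ⌊(1 - ε) * v x * L⌋₊, ?_, fun A hA => ?_⟩
  · have : ((∑ x, ⌊(1 - ε) * v x * L⌋₊ : ℕ) : ℝ) ≤ L := by
      push_cast
      calc ∑ x, (⌊(1 - ε) * v x * L⌋₊ : ℝ) ≤ ∑ x, (1 - ε) * v x * L :=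
            Finset.sum_le_sum fun x _ => Nat.floor_le (by positivity)
        _ = (1 - ε) * (∑ x, (v x : ℝ)) * L := by rw [← Finset.sum_mul, ← Finset.mul_sum]
        _ ≤ (1 - ε) * (1 / (1 - ε)) * L := by gcongr
        _ = L := by field_simp
    have h2 : (2 : ℝ) ^ (∑ x, ⌊(1 - ε) * v x * L⌋₊) ≤ p := by
      rw [← Real.rpow_natCast, ← hpow]
      exact Real.rpow_le_rpow_of_exponent_le one_le_two this
    exact_mod_cast h2
  · have hA1 : (1 : ℝ) ≤ ∑ x ∈ A.vars, (v x : ℝ) := by exact_mod_cast hv A hA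
    have h1 : (1 - ε) * L ≤ k + ((∑ x ∈ A.vars, ⌊(1 - ε) * v x * L⌋₊ : ℕ) : ℝ) := by
      push_cast
      calc (1 - ε) * L ≤ (1 - ε) * L * ∑ x ∈ A.vars, (v x : ℝ) :=
            le_mul_of_one_le_right (by positivity) hA1
        _ = ∑ x ∈ A.vars, (1 - ε) * v x * L := by
            rw [Finset.mul_sum]; exact Finset.sum_congr rfl fun x _ => by ring
        _ ≤ ∑ x ∈ A.vars, (1 + (⌊(1 - ε) * v x * L⌋₊ : ℝ)) :=
            Finset.sum_le_sum fun x _ => by linarith [Nat.lt_floor_add_one ((1 - ε) * v x * L)]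
        _ ≤ _ := by
            rw [Finset.sum_add_distrib]
            have : A.vars.card ≤ k := by simpa using Finset.card_le_univ A.vars
            have : (A.vars.card : ℝ) ≤ k := by exact_mod_cast this
            simpa using this
    rw [← Real.rpow_natCast, ← Real.rpow_natCast, ← Real.rpow_add two_pos]
    calc (p : ℝ) ^ (1 - ε) = 2 ^ ((1 - ε) * L) := by
          rw [mul_comm, Real.rpow_mul zero_le_two, hpow]
      _ ≤ _ := Real.rpow_le_rpow_of_exponent_le one_le_two h1

/-- The empty sum cannot reach 1, so no cover exists if some atom has no variables. Positive arity
is needed because a nullary relation has 0 bits even when it contains a tuple. -/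
theorem InGammaOne.ar_pos {q : ConjQuery ar k} {ε : ℝ} (hε₁ : ε < 1) (hq : q.InGammaOne ε)
    {A : Atom ar k} (hA : A ∈ q.atoms) : 1 ≤ ar A.rel := by
  have hδ : 0 < 1 - ε := by linarith
  obtain ⟨v, hv, -⟩ := exists_cover_of_tauStar_le (by positivity) hq
  by_contra h
  have : IsEmpty (Fin (ar A.rel)) := by rw [Nat.lt_one_iff.1 (not_le.1 h)]; infer_instance
  have := hv A hA
  simp [Atom.vars] at this

end ConjQuery

/-! ### The HyperCube algorithm -/

namespace ConjQuery

variable {σ : Type*} {ar : σ → ℕ} {k : ℕ}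

/-- A fact is an atom of the query with a tuple of values for its arguments. -/
abbrev Fact (q : ConjQuery ar k) (n : ℕ) : Type _ :=
  Σ A : {A // A ∈ q.atoms}, (Fin (ar A.1.rel) → Fin n)

open Classical in
/-- The facts in `D` that are relevant to server `s` if each potential answer `u` is to be found
by its owner `own u`. -/
noncomputable def relevant (q : ConjQuery ar k) {n p : ℕ} (own : (Fin k → Fin n) → Fin p)
    (D : Database ar n) (s : Fin p) : Finset (q.Fact n) :=
  Finset.univ.sigma fun A => (D A.1.rel).filter fun t => ∃ u, u ∘ A.1.args = t ∧ own u = s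

/-- The HyperCube algorithm: send every fact to all servers to which it is relevant. -/
noncomputable def hyperCube (q : ConjQuery ar k) (W : Type*) {n p : ℕ}
    (own : (Fin k → Fin n) → Fin p) (enc : Finset (q.Fact n) → List Bool) :
    MPCAlgorithm ar W n p k where
  input _ D s := enc (q.relevant own D s)
  send _ _ _ := []
  output s h := {u | own u = s ∧ ∀ A : {A // A ∈ q.atoms},
    ∃ w, ⟨A, u ∘ A.1.args⟩ ∈ Function.invFun enc (h.first w)}

variable {q : ConjQuery ar k} {W : Type*} {n p : ℕ} {own : (Fin k → Fin n) → Fin p}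
  {enc : Finset (q.Fact n) → List Bool}

theorem iUnion_hyperCube_output (henc : Function.Injective enc) (I : Database ar n)
    (loc : (S : σ) → (Fin (ar S) → Fin n) → W) :
    (⋃ s, (q.hyperCube W own enc).output s
      ((q.hyperCube W own enc).history (I.fragment loc) 1 s)) = q.eval I := by
  ext u
  simp only [Set.mem_iUnion, hyperCube, MPCAlgorithm.history, Function.leftInverse_invFun henc _,
    relevant, Finset.mem_sigma, Finset.mem_univ, Finset.mem_filter, true_and, Database.fragment,
    eval, Set.mem_ofPred_eq]
  constructor
  · rintro ⟨s, -, h⟩ A hA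
    obtain ⟨w, ⟨h, -⟩, -⟩ := h ⟨A, hA⟩
    exact h
  · exact fun h => ⟨own u, rfl, fun A => ⟨_, ⟨h A.1 A.2, rfl⟩, u, rfl, rfl⟩⟩

open Classical in
-- Each tuple lies on exactly one input server, so the counts over the fragments add up to a count
-- over the whole relation, and `loc` disappears.
theorem hyperCube_load [Fintype W] {ℓ : ℕ} (hlen : ∀ s, (enc s).length = ℓ * s.card)
    (I : Database ar n) (loc : (S : σ) → (Fin (ar S) → Fin n) → W) (s : Fin p) :
    (q.hyperCube W own enc).load (I.fragment loc) 1 s =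
      ℓ * ∑ A : {A // A ∈ q.atoms},
        ((I A.1.rel).filter fun t => ∃ u, u ∘ A.1.args = t ∧ own u = s).card := by
  simp only [MPCAlgorithm.load, hyperCube, hlen, relevant, Finset.card_sigma]
  rw [← Finset.mul_sum, Finset.sum_comm]
  congr 1
  refine Finset.sum_congr rfl fun A _ => ?_
  rw [Finset.card_eq_sum_card_fiberwise (f := loc A.1.rel) (t := Finset.univ) (by simp)]
  refine Finset.sum_congr rfl fun w _ => ?_
  rw [Database.fragment, Finset.filter_comm]

/-- The owner of a potential answer: each coordinate is hashed by random bits. -/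
def hashOwner {b : Fin k → ℕ} {N : ℕ} (g : (Σ x : Fin k, Fin n × Fin (b x)) ↪ Fin N)
    (e : ((x : Fin k) → Fin (b x) → Bool) ↪ Fin p) (ω : Fin N → Bool) (u : Fin k → Fin n) :
    Fin p :=
  e fun x i => ω (g ⟨x, u x, i⟩)

open Classical in
/-- A tail bound for the number of tuples of a matching that are relevant to a server. -/
theorem card_hashOwner_heavy_le {b : Fin k → ℕ} {N : ℕ}
    (g : (Σ x : Fin k, Fin n × Fin (b x)) ↪ Fin N)
    (e : ((x : Fin k) → Fin (b x) → Bool) ↪ Fin p) {a : ℕ} (args : Fin a → Fin k)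
    (R : Finset (Fin a → Fin n)) (hR : ∀ t ∈ R, ∀ t' ∈ R, ∀ i, t i = t' i → t = t')
    (s : Fin p) (T : ℕ) :
    ((Finset.univ.filter fun ω : Fin N → Bool =>
      T ≤ (R.filter fun t => ∃ u, u ∘ args = t ∧ hashOwner g e ω u = s).card).card : ℝ)
      ≤ R.card.choose T * (2 ^ N * (1 / 2 ^ (∑ x ∈ Finset.univ.image args, b x)) ^ T) := by
  refine card_filter_le_choose_mul R
    (fun t (ω : Fin N → Bool) => ∃ u, u ∘ args = t ∧ hashOwner g e ω u = s) T _
    fun S hS hST => ?_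
  -- A server outside the range of `e` owns nothing, so the event is impossible unless `S` is empty.
  by_cases hs : ∃ c, e c = s
  swap
  · rcases S.eq_empty_or_nonempty with rfl | ⟨t, ht⟩
    · subst hST
      simp
    · have : (Finset.univ.filter fun ω : Fin N → Bool =>
          ∀ t ∈ S, ∃ u, u ∘ args = t ∧ hashOwner g e ω u = s) = ∅ := by
        refine Finset.filter_false_of_mem fun ω _ h => ?_
        obtain ⟨u, -, hu⟩ := h t ht
        exact hs ⟨_, hu⟩
      rw [this]
      simp only [Finset.card_empty, Nat.cast_zero]
      positivity
  obtain ⟨c, rfl⟩ := hs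
  have hj : ∀ x : ↥(Finset.univ.image args), ∃ j, args j = x.1 := fun x => by
    obtain ⟨j, -, h⟩ := Finset.mem_image.1 x.2
    exact ⟨j, h⟩
  choose j hj using hj
  set P : Finset ((_ : Fin a → Fin n) × (x : ↥(Finset.univ.image args)) × Fin (b x.1)) :=
    S.sigma fun _ => Finset.univ with hP
  -- The hash bits that must agree with `c` if all tuples of `S` are relevant. One column `j x` per
  -- variable suffices, even if a variable is repeated in the atom.
  set J : Finset (Σ x : Fin k, Fin n × Fin (b x)) :=
    P.image fun y => ⟨y.2.1.1, y.1 (j y.2.1), y.2.2⟩ with hJ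
  have hJcard : J.card = T * ∑ x ∈ Finset.univ.image args, b x := by
    rw [hJ, Finset.card_image_of_injOn, hP, Finset.card_sigma, Finset.sum_const, hST, smul_eq_mul,
      Finset.card_univ, Fintype.card_sigma]
    · simp only [Fintype.card_fin]
      exact congrArg _ (Finset.sum_coe_sort _ b)
    -- The matching property enters here: two tuples sharing a bit agree in a column, hence are
    -- equal.
    · rintro ⟨t, ⟨x, hx⟩, i⟩ hy ⟨t', ⟨x', hx'⟩, i'⟩ hy' h
      simp only [Sigma.mk.injEq] at h
      obtain ⟨rfl, h⟩ := h
      simp only [heq_eq_eq, Prod.mk.injEq] at h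
      obtain ⟨h, rfl⟩ := h
      have ht : t ∈ S := by simpa [hP] using hy
      have ht' : t' ∈ S := by simpa [hP] using hy'
      rw [hR t (hS ht) t' (hS ht') _ h]
  have hbits := card_filter_prescribed_mul g J fun y => c y.1 y.2.2
  have hsub : (Finset.univ.filter fun ω : Fin N → Bool =>
      ∀ t ∈ S, ∃ u, u ∘ args = t ∧ hashOwner g e ω u = e c) ⊆
      Finset.univ.filter fun ω : Fin N → Bool => ∀ y ∈ J, ω (g y) = c y.1 y.2.2 := by
    intro ω hω
    simp only [Finset.mem_filter, Finset.mem_univ, true_and] at hω ⊢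
    intro y hy
    obtain ⟨⟨t, x, i⟩, ht, rfl⟩ := Finset.mem_image.1 hy
    obtain ⟨u, rfl, hu⟩ := hω t (by simpa [hP] using ht)
    have := congrFun (congrFun (e.injective hu) x.1) i
    simpa [hj] using this
  have hle : ((Finset.univ.filter fun ω : Fin N → Bool =>
      ∀ t ∈ S, ∃ u, u ∘ args = t ∧ hashOwner g e ω u = e c).card : ℝ) * 2 ^ J.card ≤ 2 ^ N := by
    exact_mod_cast (Nat.mul_le_mul_right _ (Finset.card_le_card hsub)).trans hbits
  rw [div_pow, one_pow, ← pow_mul, mul_one_div, le_div_iff₀ (by positivity), mul_comm _ T, ← hJcard]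
  exact hle

end ConjQuery

-- The one-round protocol

universe u

namespace ConjQuery

variable {σ : Type*} {ar : σ → ℕ} {k : ℕ}

theorem card_fact_le (q : ConjQuery ar k) {n : ℕ} (hn : 1 ≤ n) :
    Fintype.card (q.Fact n) ≤
      2 ^ ((q.atoms.card + ∑ A ∈ q.atoms, ar A.rel + 1) * (Nat.log 2 n + 1)) := by
  set D := ∑ A ∈ q.atoms, ar A.rel with hD
  have h1 : Fintype.card (q.Fact n) ≤ q.atoms.card * n ^ D := by
    rw [Fintype.card_sigma]
    refine (Finset.sum_le_card_nsmul _ _ (n ^ D) fun A _ => ?_).trans (by simp)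
    rw [Fintype.card_fun, Fintype.card_fin, Fintype.card_fin]
    exact Nat.pow_le_pow_right hn
      (Finset.single_le_sum (f := fun A : Atom ar k => ar A.rel) (fun _ _ => Nat.zero_le _) A.2)
  have h2 : n ≤ 2 ^ (Nat.log 2 n + 1) := (Nat.lt_pow_succ_log_self one_lt_two n).le
  calc Fintype.card (q.Fact n) ≤ 2 ^ q.atoms.card * (2 ^ (Nat.log 2 n + 1)) ^ D :=
        h1.trans (Nat.mul_le_mul Nat.lt_two_pow_self.le (Nat.pow_le_pow_left h2 D))
    _ = 2 ^ (q.atoms.card + (Nat.log 2 n + 1) * D) := by rw [← pow_mul, ← pow_add]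
    _ ≤ _ := Nat.pow_le_pow_right two_pos (by nlinarith [Nat.zero_le (q.atoms.card * Nat.log 2 n)])

/-- For all large numbers of random bits there is a protocol for `q` with `r` rounds in which every
answer is reported by its owner only and the failure event does not depend on the placement. -/
def HasProtocol (q : ConjQuery ar k) (ε : ℝ) (r : ℕ) : Prop :=
  ∀ η : ℝ, 0 < η → ∀ κ : ℕ, ∃ C : ℝ, 0 < C ∧ ∀ (p n : ℕ) (M : ℝ), 1 ≤ p → 2 ≤ n →
    (p : ℝ) ^ (1 - ε) * Real.logb 2 p * Real.logb 2 n ≤ M → ∀ (W : Type u) [Fintype W],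
      ∃ N₀ : ℕ, ∀ N ≥ N₀, ∃ (A : (Fin N → Bool) → MPCAlgorithm ar W n p k)
        (own : (Fin N → Bool) → (Fin k → Fin n) → Fin p),
        (∀ ω s h, ∀ t ∈ (A ω).output s h, own ω t = s) ∧
        ∀ I : Database ar n, I.IsMatching → (∀ S, I.relSize S ≤ M) →
          ∃ bad : Finset (Fin N → Bool), (bad.card : ℝ) ≤ η / (p : ℝ) ^ κ * 2 ^ N ∧
            ∀ ω ∉ bad, ∀ loc, (A ω).Computes (I.fragment loc) r
              (C * (M / (p : ℝ) ^ (1 - ε))) (q.eval I)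

/-- The cardinality of a relation of positive arity is bounded by its size. -/
theorem card_le_of_relSize_le {n : ℕ} (hn : 2 ≤ n) {I : Database ar n} {S : σ} {M : ℝ}
    (hS : 1 ≤ ar S) (h : I.relSize S ≤ M) : ((I S).card : ℝ) * Real.logb 2 n ≤ M := by
  have hlog : 0 ≤ Real.logb 2 n :=
    Real.logb_nonneg one_lt_two (by exact_mod_cast (one_le_two.trans hn))
  refine le_trans ?_ h
  rw [Database.relSize, mul_assoc]
  exact le_mul_of_one_le_left (by positivity) (by exact_mod_cast hS)

open Classical in
theorem hyperCube_computes {q : ConjQuery ar k} {W : Type*} [Fintype W] {n p : ℕ}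
    {own : (Fin k → Fin n) → Fin p} {enc : Finset (q.Fact n) → List Bool}
    (henc : Function.Injective enc) {ℓ : ℕ} (hlen : ∀ s, (enc s).length = ℓ * s.card)
    {I : Database ar n} {X L : ℝ}
    (hX : ∀ s, ∀ A : {A // A ∈ q.atoms},
      (((I A.1.rel).filter fun t => ∃ u, u ∘ A.1.args = t ∧ own u = s).card : ℝ) ≤ X)
    (hL : ℓ * (q.atoms.card * X) ≤ L) (loc : (S : σ) → (Fin (ar S) → Fin n) → W) :
    (q.hyperCube W own enc).Computes (I.fragment loc) 1 L (q.eval I) := by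
  refine ⟨iUnion_hyperCube_output henc I loc, fun i hi hi' s => ?_⟩
  obtain rfl : i = 1 := le_antisymm hi' hi
  rw [hyperCube_load hlen]
  refine le_trans ?_ hL
  push_cast
  gcongr
  refine (Finset.sum_le_card_nsmul _ _ X fun A _ => hX s A).trans ?_
  simp

theorem two_pow_bound {p : ℕ} (hp : 1 ≤ p) {c : ℝ} (hc : 0 < c) {κ T : ℕ}
    (h : Real.logb 2 c + (κ + 1) * Real.logb 2 p ≤ T) : c * (p : ℝ) ^ (κ + 1) ≤ 2 ^ T := by
  have hp0 : (0 : ℝ) < p := by exact_mod_cast hp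
  rw [← Real.rpow_natCast 2, ← Real.logb_le_iff_le_rpow one_lt_two (by positivity),
    Real.logb_mul (by positivity) (by positivity), Real.logb_pow]
  exact_mod_cast h

/-- The HyperCube algorithm computes a query in `Γ¹_ε` in one round. -/
theorem InGammaOne.hasProtocol {q : ConjQuery ar k} {ε : ℝ} (hε₁ : ε < 1)
    (hq : q.InGammaOne ε) : HasProtocol.{u} q ε 1 := by
  classical
  intro η hη κ
  set a := q.atoms.card with ha
  set D := ∑ A ∈ q.atoms, ar A.rel with hD
  set Λ := |Real.logb 2 ((a + 1) / η)| with hΛ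
  -- The three terms pay for the Chernoff bound, for p^(κ+1) (one factor p from the union bound over
  -- servers), and for the constant (a + 1) / η.
  set K : ℝ := 6 * 2 ^ k + (κ + 1) + Λ with hK
  have hK1 : 1 ≤ K := by
    have : (1 : ℝ) ≤ 2 ^ k := one_le_pow₀ one_le_two
    have : 0 ≤ Λ := abs_nonneg _
    have : (0 : ℝ) ≤ κ := κ.cast_nonneg
    linarith
  refine ⟨2 * (a + D + 1) * (a + 1) * K, by positivity, fun p n M hp hn hM W _ => ?_⟩
  have hp1 : (1 : ℝ) ≤ p := by exact_mod_cast hp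
  have hp0 : (0 : ℝ) < p := by linarith
  set lg := Real.logb 2 n with hlg
  have hlg1 : 1 ≤ lg := by
    rw [hlg, Real.le_logb_iff_rpow_le one_lt_two (by positivity), Real.rpow_one]
    exact_mod_cast hn
  set pe := (p : ℝ) ^ (1 - ε) with hpe
  have hpe0 : 0 < pe := by positivity
  set μ := M / (pe * lg) with hμ
  have hμM : M = μ * pe * lg := by rw [hμ]; field_simp
  have hμp : Real.logb 2 p ≤ μ := by
    rw [hμ, le_div_iff₀ (by positivity)]
    linarith
  have hlp0 : 0 ≤ Real.logb 2 p := Real.logb_nonneg one_lt_two hp1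
  have hμ0 : 0 ≤ μ := hlp0.trans hμp
  obtain ⟨b, hb, hbA⟩ := exists_shares hε₁ hq hp
  obtain ⟨e⟩ : Nonempty (((x : Fin k) → Fin (b x) → Bool) ↪ Fin p) :=
    Function.Embedding.nonempty_of_card_le (by
      simpa [Fintype.card_pi, Finset.prod_pow_eq_pow_sum] using hb)
  obtain ⟨enc, henc, hlen⟩ := exists_finset_code (q.Fact n)
    (ℓ := (a + D + 1) * (Nat.log 2 n + 1)) (Nat.mul_pos (by omega) (by omega))
    (q.card_fact_le (by omega))
  refine ⟨Fintype.card (Σ x : Fin k, Fin n × Fin (b x)), fun N hN => ?_⟩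
  obtain ⟨g⟩ : Nonempty ((Σ x : Fin k, Fin n × Fin (b x)) ↪ Fin N) :=
    Function.Embedding.nonempty_of_card_le (by rwa [Fintype.card_fin])
  refine ⟨fun ω => q.hyperCube W (hashOwner g e ω) enc, hashOwner g e, fun ω s h t ht => ht.1,
    fun I hI hsize => ?_⟩
  have hm : ∀ A : {A // A ∈ q.atoms}, ((I A.1.rel).card : ℝ) ≤ μ * pe := by
    intro A
    have := card_le_of_relSize_le hn (hq.ar_pos hε₁ A.2) (hsize A.1.rel)
    rw [hμM] at this
    exact le_of_mul_le_mul_right this (by linarith)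
  have hL : (((a + D + 1) * (Nat.log 2 n + 1) : ℕ) : ℝ) * (q.atoms.card * (K * μ)) ≤
      2 * (a + D + 1) * (a + 1) * K * (M / pe) := by
    have h1 : (Nat.log 2 n : ℝ) + 1 ≤ 2 * lg := by
      have : (Nat.log 2 n : ℝ) ≤ lg := Real.natLog_le_logb n 2
      linarith
    have h2 : M / pe = lg * μ := by rw [hμM]; field_simp
    rw [h2, ← ha]
    push_cast
    calc ((a : ℝ) + D + 1) * (Nat.log 2 n + 1) * (a * (K * μ))
        ≤ ((a : ℝ) + D + 1) * (2 * lg) * ((a + 1) * (K * μ)) := by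
          have h3 : 0 ≤ K * μ := mul_nonneg (by linarith) hμ0
          have h4 : (a : ℝ) * (K * μ) ≤ (a + 1) * (K * μ) := by linarith
          have h5 : (0 : ℝ) ≤ a + D + 1 := by exact_mod_cast Nat.zero_le _
          exact mul_le_mul (mul_le_mul_of_nonneg_left h1 h5) h4
            (mul_nonneg a.cast_nonneg h3) (mul_nonneg h5 (by linarith))
      _ = _ := by ring
  set bad := Finset.univ.filter fun ω : Fin N → Bool => ¬ ∀ loc,
    (q.hyperCube W (hashOwner g e ω) enc).Computes (I.fragment loc) 1
      (2 * (a + D + 1) * (a + 1) * K * (M / pe)) (q.eval I) with hbad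
  refine ⟨bad, ?_, fun ω hω => by simpa [hbad] using hω⟩
  have hheavy : ∀ ω ∈ bad, ∃ s, ∃ A : {A // A ∈ q.atoms}, K * μ <
      (((I A.1.rel).filter fun t => ∃ u, u ∘ A.1.args = t ∧ hashOwner g e ω u = s).card : ℝ) := by
    intro ω hω
    by_contra! hcon
    exact (Finset.mem_filter.1 hω).2 fun loc => hyperCube_computes henc hlen hcon hL loc
  -- For p = 1 the bound log₂ p ≤ μ is void and μ may be small, but a relation has at most μ tuples
  -- in all, so nothing can fail.
  rcases hp.eq_or_lt with rfl | hp2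
  · have : bad = ∅ := by
      refine Finset.eq_empty_of_forall_notMem fun ω hω => ?_
      obtain ⟨s, A, h⟩ := hheavy ω hω
      refine absurd h (not_lt.2 ?_)
      calc _ ≤ ((I A.1.rel).card : ℝ) := by exact_mod_cast Finset.card_filter_le _ _
        _ ≤ μ * pe := hm A
        _ = 1 * μ := by simp [hpe]
        _ ≤ K * μ := by gcongr
    rw [this]
    simp only [Finset.card_empty, Nat.cast_zero]
    positivity
  have hμ1 : 1 ≤ μ := by
    refine le_trans ?_ hμp
    rw [Real.le_logb_iff_rpow_le one_lt_two hp0, Real.rpow_one]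
    exact_mod_cast hp2
  set T := ⌈K * μ⌉₊ with hT
  have hKT : K * μ ≤ T := Nat.le_ceil _
  have hKμ : 6 * 2 ^ k * μ + (κ + 1) * Real.logb 2 p + Λ ≤ K * μ := by
    have h1 : (κ + 1) * Real.logb 2 p ≤ (κ + 1) * μ := by gcongr
    have h2 : Λ ≤ Λ * μ := le_mul_of_one_le_right (abs_nonneg _) hμ1
    rw [hK, add_mul, add_mul]
    linarith
  set E : Fin p × {A // A ∈ q.atoms} → Finset (Fin N → Bool) := fun y =>
    Finset.univ.filter fun ω => T ≤ ((I y.2.1.rel).filter fun t =>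
      ∃ u, u ∘ y.2.1.args = t ∧ hashOwner g e ω u = y.1).card with hE
  have hEcard : ∀ y, ((E y).card : ℝ) ≤ 2 ^ N * (1 / 2) ^ T := by
    rintro ⟨s, A⟩
    refine (card_hashOwner_heavy_le g e A.1.args (I A.1.rel) (hI A.1.rel) s T).trans ?_
    rw [mul_left_comm]
    refine mul_le_mul_of_nonneg_left (choose_mul_pow_le (by positivity) ?_) (by positivity)
    have h1 := hbA A.1 A.2
    change pe ≤ 2 ^ k * 2 ^ (∑ x ∈ Finset.univ.image A.1.args, b x) at h1
    rw [mul_one_div]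
    have h2 : ((I A.1.rel).card : ℝ) / 2 ^ (∑ x ∈ Finset.univ.image A.1.args, b x) ≤
        2 ^ k * μ := by
      rw [div_le_iff₀ (by positivity)]
      calc _ ≤ μ * pe := hm A
        _ ≤ μ * (2 ^ k * 2 ^ (∑ x ∈ Finset.univ.image A.1.args, b x)) := by gcongr
        _ = _ := by ring
    have h3 : 0 ≤ (κ + 1) * Real.logb 2 p := by positivity
    have h4 : 0 ≤ Λ := abs_nonneg _
    linarith
  have hcard : (bad.card : ℝ) ≤ p * a * (2 ^ N * (1 / 2) ^ T) := by
    have hsub : bad ⊆ Finset.univ.biUnion E := by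
      intro ω hω
      obtain ⟨s, A, h⟩ := hheavy ω hω
      refine Finset.mem_biUnion.2 ⟨(s, A), Finset.mem_univ _, Finset.mem_filter.2
        ⟨Finset.mem_univ _, Nat.ceil_le.2 h.le⟩⟩
    calc (bad.card : ℝ) ≤ ∑ y, ((E y).card : ℝ) := by
          exact_mod_cast (Finset.card_le_card hsub).trans Finset.card_biUnion_le
      _ ≤ ∑ _y : Fin p × {A // A ∈ q.atoms}, 2 ^ N * (1 / 2 : ℝ) ^ T :=
          Finset.sum_le_sum fun y _ => hEcard y
      _ = _ := by simp [ha]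
  have hT2 : (a + 1) / η * (p : ℝ) ^ (κ + 1) ≤ 2 ^ T := by
    refine two_pow_bound hp (div_pos a.cast_add_one_pos hη) ?_
    have : Real.logb 2 ((a + 1) / η) ≤ Λ := le_abs_self _
    have : 0 ≤ 6 * 2 ^ k * μ := by positivity
    linarith
  refine hcard.trans ?_
  have h5 : p * a * (1 / 2 : ℝ) ^ T ≤ η / (p : ℝ) ^ κ := by
    rw [one_div, inv_pow, ← div_eq_mul_inv, div_le_div_iff₀ (by positivity) (by positivity)]
    calc (p : ℝ) * a * p ^ κ ≤ p * (a + 1) * p ^ κ := by gcongr; linarith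
      _ = η * ((a + 1) / η * (p : ℝ) ^ (κ + 1)) := by rw [pow_succ]; field_simp
      _ ≤ η * 2 ^ T := by gcongr
  calc _ = p * a * (1 / 2 : ℝ) ^ T * 2 ^ N := by ring
    _ ≤ _ := by gcongr

end ConjQuery

/-! ### Views -/

theorem Database.mem_fragment {σ : Type*} {ar : σ → ℕ} {n : ℕ} {W : Type*} {I : Database ar n}
    {loc : (S : σ) → (Fin (ar S) → Fin n) → W} {w : W} {S : σ} {t : Fin (ar S) → Fin n} :
    t ∈ I.fragment loc w S ↔ t ∈ I S ∧ loc S t = w := by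
  simp [fragment]

namespace ConjQuery

variable {σ : Type*} {ar : σ → ℕ} {k : ℕ}

/-- Answers of a connected query on a matching database that agree on one variable are equal. -/
theorem Connected.eval_eq {q : ConjQuery ar k} (hq : q.Connected) {n : ℕ} {I : Database ar n}
    (hI : I.IsMatching) {t t' : Fin k → Fin n} (ht : t ∈ q.eval I) (ht' : t' ∈ q.eval I)
    {x : Fin k} (hx : t x = t' x) : t = t' := by
  have key : ∀ y z, (∃ A ∈ q.atoms, y ∈ A.vars ∧ z ∈ A.vars) → t y = t' y → t z = t' z := by
    rintro y z ⟨A, hA, hy, hz⟩ h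
    obtain ⟨i, -, rfl⟩ := Finset.mem_image.1 hy
    obtain ⟨j, -, rfl⟩ := Finset.mem_image.1 hz
    exact congrFun (hI A.rel _ (ht A hA) _ (ht' A hA) i h) j
  funext y
  obtain ⟨w⟩ := hq x y
  induction w with
  | nil => exact hx
  | cons h _ ih =>
    refine ih ?_
    rw [SimpleGraph.fromRel_adj] at h
    rcases h.2 with h | ⟨A, hA, h₁, h₂⟩
    · exact key _ _ h hx
    · exact key _ _ ⟨A, hA, h₂, h₁⟩ hx

/-- The database of the views defined by queries. -/
noncomputable def views {J : Type*} {a : J → ℕ} {n : ℕ} (qs : (j : J) → ConjQuery ar (a j))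
    (I : Database ar n) : Database a n :=
  fun j => (Set.toFinite ((qs j).eval I)).toFinset

section Views

variable {J : Type*} {a : J → ℕ} {n : ℕ} {qs : (j : J) → ConjQuery ar (a j)} {I : Database ar n}

theorem mem_views {j : J} {t : Fin (a j) → Fin n} :
    t ∈ views qs I j ↔ t ∈ (qs j).eval I :=
  Set.Finite.mem_toFinset _

theorem views_isMatching (hqs : ∀ j, (qs j).Connected) (hI : I.IsMatching) :
    (views qs I).IsMatching :=
  fun j _ ht _ ht' _ h => (hqs j).eval_eq hI (mem_views.1 ht) (mem_views.1 ht') h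

/-- By connectedness an answer is determined by its restriction to one atom with a variable, so a
view has at most as many tuples as some relation of `I`. The factor `a j` is its arity. -/
theorem relSize_views_le (hn : 2 ≤ n) (hqs : ∀ j, (qs j).Connected) (hI : I.IsMatching) {M : ℝ}
    (hsize : ∀ S, I.relSize S ≤ M) (j : J) : (views qs I).relSize j ≤ a j * M := by
  rcases Nat.eq_zero_or_pos (a j) with h0 | h0
  · simp [Database.relSize, h0]
  obtain ⟨A, hA, hx⟩ := (qs j).full ⟨0, h0⟩
  obtain ⟨i, -, hi⟩ := Finset.mem_image.1 hx
  have hle : (views qs I j).card ≤ (I A.rel).card := by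
    refine Finset.card_le_card_of_injOn (fun t => t ∘ A.args)
      (fun t ht => mem_views.1 ht A hA) fun t ht t' ht' h => ?_
    refine (hqs j).eval_eq hI (mem_views.1 ht) (mem_views.1 ht') (x := A.args i) ?_
    exact congrFun h i
  have hlog : 0 ≤ Real.logb 2 n :=
    Real.logb_nonneg one_lt_two (by exact_mod_cast (one_le_two.trans hn))
  have := card_le_of_relSize_le hn (Nat.one_le_of_lt i.2) (hsize A.rel)
  rw [Database.relSize, mul_assoc]
  refine mul_le_mul_of_nonneg_left (le_trans ?_ this) (Nat.cast_nonneg _)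
  gcongr

theorem eval_views {m : ℕ} {a : Fin m → ℕ} {qs : (j : Fin m) → ConjQuery ar (a j)}
    {q₀ : ConjQuery a k} {q : ConjQuery ar k} (h : q.IsSubstitution q₀ qs) :
    q₀.eval (views qs I) = q.eval I := by
  ext t
  constructor
  · intro ht A hA
    obtain ⟨B, hB, A', hA', rfl⟩ := (h A).1 hA
    exact mem_views.1 (ht B hB) A' hA'
  · intro ht B hB
    exact mem_views.2 fun A' hA' => ht (A'.rename B.args) ((h _).2 ⟨B, hB, A', hA', rfl⟩)

end Views

end ConjQuery

/-! ### Composition of algorithms -/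

/-- The part of a history that belongs to one of several algorithms run in parallel. -/
def History.map {W : Type*} {p : ℕ} (f : List Bool → List Bool) (h : History W p) : History W p :=
  ⟨fun w => f (h.first w), h.later.map fun l s => f (l s)⟩

namespace MPCAlgorithm

variable {σ : Type*} {ar : σ → ℕ} {W : Type*} {n p k m : ℕ} {a : Fin m → ℕ}

/-- Run the algorithms `B j` in parallel for `R` rounds, and then, for one round, the algorithm
`A₀` on the results, which are stored on the servers that report them. -/
noncomputable def compose (R : ℕ) (pack : (Fin m → List Bool) → List Bool)
    (B : (j : Fin m) → MPCAlgorithm ar W n p (a j)) (A₀ : MPCAlgorithm a (Fin p) n p k) :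
    MPCAlgorithm ar W n p k where
  input w D s := pack fun j => (B j).input w D s
  send s h s' :=
    -- `h.later.length + 1` rounds have been received; once this is `R`, the views are complete and
    -- the next message belongs to `A₀`.
    if h.later.length + 1 < R then
      pack fun j => (B j).send s (h.map fun l => Function.invFun pack l j) s'
    else
      A₀.input s (fun j => (Set.toFinite
        ((B j).output s (h.map fun l => Function.invFun pack l j))).toFinset) s'
  -- The latest messages play the part of the first-round messages of `A₀`, with the servers as its
  -- input servers. The default is never reached after `R + 1` rounds with `R ≥ 1`.
  output s h := A₀.output s ⟨h.later.headD fun _ => [], []⟩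

theorem length_later_history (A : MPCAlgorithm ar W n p k) (D : W → Database ar n) (i : ℕ)
    (s : Fin p) : (A.history D (i + 1) s).later.length = i := by
  induction i with
  | zero => rfl
  | succ i ih => simp [history, ih]

variable {R : ℕ} {pack : (Fin m → List Bool) → List Bool}
  {B : (j : Fin m) → MPCAlgorithm ar W n p (a j)} {A₀ : MPCAlgorithm a (Fin p) n p k}
  {D : W → Database ar n}

theorem compose_send_of_lt {h : History W p} (hh : h.later.length + 1 < R) (s s' : Fin p) :
    (compose R pack B A₀).send s h s' =
      pack fun j => (B j).send s (h.map fun l => Function.invFun pack l j) s' :=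
  if_pos hh

theorem compose_send_of_not_lt {h : History W p} (hh : ¬ h.later.length + 1 < R) (s s' : Fin p) :
    (compose R pack B A₀).send s h s' =
      A₀.input s (fun j => (Set.toFinite
        ((B j).output s (h.map fun l => Function.invFun pack l j))).toFinset) s' :=
  if_neg hh

/-- Through round `R` each `B j` is simulated faithfully: unpacking the common history recovers its
own. The induction needs all `j` at once, since a packed message depends on every component. -/
theorem map_history_compose (hpack : Function.Injective pack) (j : Fin m) {i : ℕ} (hi : i < R)
    (s : Fin p) :
    ((compose R pack B A₀).history D (i + 1) s).map (fun l => Function.invFun pack l j) =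
      (B j).history D (i + 1) s := by
  induction i generalizing s j with
  | zero => simp [history, History.map, compose, Function.leftInverse_invFun hpack _]
  | succ i ih =>
    have ih' := fun j => ih j (Nat.lt_of_succ_lt hi)
    rw [history, history, ← ih' j s]
    simp only [History.map, List.map_cons, History.mk.injEq, true_and, List.cons.injEq, and_true]
    funext s'
    rw [compose_send_of_lt (by rwa [length_later_history]), Function.leftInverse_invFun hpack _,
      ih' j s']

theorem send_compose_of_lt (hpack : Function.Injective pack) {i : ℕ} (hi : i + 1 < R)
    (s s' : Fin p) :
    (compose R pack B A₀).send s ((compose R pack B A₀).history D (i + 1) s) s' =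
      pack fun j => (B j).send s ((B j).history D (i + 1) s) s' := by
  rw [compose_send_of_lt (by rwa [length_later_history])]
  simp only [map_history_compose hpack _ (Nat.lt_of_succ_lt hi)]

theorem send_compose_last (hpack : Function.Injective pack) {i : ℕ} (hi : i + 1 = R)
    (s s' : Fin p) :
    (compose R pack B A₀).send s ((compose R pack B A₀).history D (i + 1) s) s' =
      A₀.input s (fun j => (Set.toFinite
        ((B j).output s ((B j).history D (i + 1) s))).toFinset) s' := by
  rw [compose_send_of_not_lt (by rw [length_later_history]; omega)]
  simp only [map_history_compose hpack _ (show i < R by omega)]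

theorem load_compose [Fintype W] (hpack : Function.Injective pack) {ℓ : ℕ}
    (hlen : ∀ l, (pack l).length = ℓ * ∑ j, (l j).length) {i : ℕ} (hi : i < R) (s : Fin p) :
    (compose R pack B A₀).load D (i + 1) s = ℓ * ∑ j, (B j).load D (i + 1) s := by
  cases i with
  | zero =>
    simp only [load, compose, hlen]
    rw [← Finset.mul_sum, Finset.sum_comm]
  | succ i =>
    simp only [load, send_compose_of_lt hpack hi, hlen]
    rw [← Finset.mul_sum, Finset.sum_comm]

/-- If the algorithms `B j` compute the views and every tuple is reported by its owner only, then
the last round is that of `A₀` on the database of the views, stored according to the owners. -/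
theorem compose_computes [Fintype W] (hpack : Function.Injective pack) {ℓ : ℕ}
    (hlen : ∀ l, (pack l).length = ℓ * ∑ j, (l j).length) (hR : 1 ≤ R)
    {qs : (j : Fin m) → ConjQuery ar (a j)} {I : Database ar n}
    {own : (j : Fin m) → (Fin (a j) → Fin n) → Fin p}
    (hown : ∀ j s h, ∀ t ∈ (B j).output s h, own j t = s) {L₁ : Fin m → ℝ} {L₀ L : ℝ}
    (hB : ∀ j, (B j).Computes D R (L₁ j) ((qs j).eval I)) {T : Set (Fin k → Fin n)}
    (hA₀ : A₀.Computes ((ConjQuery.views qs I).fragment own) 1 L₀ T)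
    (hL₀ : L₀ ≤ L) (hL₁ : ℓ * ∑ j, L₁ j ≤ L) :
    (compose R pack B A₀).Computes D (R + 1) L T := by
  obtain ⟨i₀, rfl⟩ : ∃ i₀, R = i₀ + 1 := ⟨R - 1, by omega⟩
  have hfrag : ∀ s : Fin p, (fun j => (Set.toFinite
      ((B j).output s ((B j).history D (i₀ + 1) s))).toFinset) =
      (ConjQuery.views qs I).fragment own s := by
    intro s
    funext j
    ext t
    rw [Set.Finite.mem_toFinset, Database.mem_fragment, ConjQuery.mem_views,
      ← (hB j).1, Set.mem_iUnion]
    constructor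
    · exact fun h => ⟨⟨s, h⟩, hown j s _ t h⟩
    · rintro ⟨⟨s', h⟩, rfl⟩
      rw [hown j s' _ t h]
      exact h
  have hsend : ∀ s s', (compose (i₀ + 1) pack B A₀).send s
      ((compose (i₀ + 1) pack B A₀).history D (i₀ + 1) s) s' =
      A₀.input s ((ConjQuery.views qs I).fragment own s) s' := fun s s' => by
    rw [send_compose_last hpack rfl, hfrag]
  refine ⟨?_, fun i hi hi' s => ?_⟩
  · rw [← hA₀.1]
    exact Set.iUnion_congr fun s =>
      congrArg (fun f => A₀.output s ⟨f, []⟩) (funext fun s' => hsend s' s)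
  · obtain ⟨i, rfl⟩ : ∃ i', i = i' + 1 := ⟨i - 1, by omega⟩
    rcases (Nat.le_of_succ_le_succ hi').lt_or_eq with hlt | rfl
    · rw [load_compose hpack hlen hlt]
      refine le_trans ?_ hL₁
      push_cast
      gcongr with j
      exact (hB j).2 (i + 1) hi hlt s
    · refine le_trans ?_ hL₀
      refine le_trans (le_of_eq ?_) (hA₀.2 1 le_rfl le_rfl s)
      simp only [load, hsend]

end MPCAlgorithm

/-! ### Induction on the number of rounds -/

namespace ConjQuery

variable {σ : Type*} {ar : σ → ℕ} {k : ℕ}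

/-- A query over views is computed in one more round than the views. -/
theorem HasProtocol.substitution {m : ℕ} {a : Fin m → ℕ} {qs : (j : Fin m) → ConjQuery ar (a j)}
    {q₀ : ConjQuery a k} {q : ConjQuery ar k} {ε : ℝ} {R : ℕ} (hR : 1 ≤ R)
    (hconn : ∀ j, (qs j).Connected) (hqs : ∀ j, HasProtocol.{u} (qs j) ε R)
    (hq₀ : HasProtocol.{0} q₀ ε 1) (hq : q.IsSubstitution q₀ qs) :
    HasProtocol.{u} q ε (R + 1) := by
  classical
  intro η hη κ
  have hη' : 0 < η / (m + 1) := by positivity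
  choose C₁ hC₁ H₁ using fun j => hqs j (η / (m + 1)) hη' κ
  obtain ⟨C₀, hC₀, H₀⟩ := hq₀ (η / (m + 1)) hη' κ
  obtain ⟨ℓ, pack, hpack, hlen⟩ := exists_pack m
  have hC₁' : 0 ≤ ∑ j, C₁ j := Finset.sum_nonneg fun j _ => (hC₁ j).le
  -- Bounds the arity of every view; the 1 ensures c ≥ 1, so that `c * M` still satisfies the lower
  -- bound required of `M`.
  set c : ℝ := ((∑ j, a j : ℕ) : ℝ) + 1 with hc
  have hc1 : 1 ≤ c := by rw [hc]; linarith [Nat.cast_nonneg (α := ℝ) (∑ j, a j)]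
  refine ⟨ℓ * (∑ j, C₁ j) + C₀ * c, by positivity, fun p n M hp hn hM W _ => ?_⟩
  have hp1 : (1 : ℝ) ≤ p := by exact_mod_cast hp
  have hM0 : 0 ≤ M := by
    refine le_trans (mul_nonneg (mul_nonneg (by positivity) ?_) ?_) hM <;>
      refine Real.logb_nonneg one_lt_two ?_
    · exact hp1
    · exact_mod_cast one_le_two.trans hn
  have hMc : M ≤ c * M := le_mul_of_one_le_left hM0 hc1
  choose N₁ G₁ using fun j => H₁ j p n M hp hn hM W
  obtain ⟨N₀, G₀⟩ := H₀ p n (c * M) hp hn (hM.trans hMc) (Fin p)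
  -- A common number of bits lets all algorithms read the same string `ω`. No independence is
  -- needed: the `m + 1` bad events are combined by a union bound.
  refine ⟨N₀ + ∑ j, N₁ j, fun N hN => ?_⟩
  have hN₁ : ∀ j, N ≥ N₁ j := fun j =>
    ((Finset.single_le_sum (f := N₁) (fun _ _ => Nat.zero_le _) (Finset.mem_univ j)).trans
      (Nat.le_add_left _ _)).trans hN
  choose B own hown hB using fun j => G₁ j N (hN₁ j)
  obtain ⟨A₀, own₀, hown₀, hA₀⟩ := G₀ N ((Nat.le_add_right _ _).trans hN)
  refine ⟨fun ω => (MPCAlgorithm.compose R pack (fun j => B j ω) (A₀ ω)), own₀,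
    fun ω s h t ht => hown₀ ω s _ t ht, fun I hI hsize => ?_⟩
  set pe := (p : ℝ) ^ (1 - ε) with hpe
  have hpe0 : 0 < pe := by positivity
  obtain ⟨bad₀, hbad₀, hgood₀⟩ := hA₀ (views qs I) (views_isMatching hconn hI) fun j =>
    (relSize_views_le hn hconn hI hsize j).trans (by
      have : a j ≤ ∑ j, a j :=
        Finset.single_le_sum (fun _ _ => Nat.zero_le _) (Finset.mem_univ j)
      have : (a j : ℝ) ≤ ((∑ j, a j : ℕ) : ℝ) := by exact_mod_cast this
      gcongr
      linarith)
  choose bad₁ hbad₁ hgood₁ using fun j => hB j I hI hsize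
  refine ⟨bad₀ ∪ Finset.univ.biUnion bad₁, ?_, fun ω hω loc => ?_⟩
  swap
  · simp only [Finset.mem_union, Finset.mem_biUnion, Finset.mem_univ, true_and, not_or,
      not_exists] at hω
    have hMpe : 0 ≤ M / pe := by positivity
    -- The placement `own j ω` depends on the bits that `A₀` uses; this is harmless because outside
    -- `bad₀` the algorithm succeeds for all placements simultaneously.
    refine MPCAlgorithm.compose_computes hpack hlen hR (fun j => hown j ω)
      (fun j => hgood₁ j ω (hω.2 j) loc) (eval_views hq ▸ hgood₀ ω hω.1 fun j => own j ω) ?_ ?_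
    · have : 0 ≤ ℓ * (∑ j, C₁ j) * (M / pe) := by positivity
      have h2 : C₀ * (c * M / pe) = C₀ * c * (M / pe) := by ring
      linarith [add_mul (ℓ * ∑ j, C₁ j) (C₀ * c) (M / pe)]
    · have : 0 ≤ C₀ * c * (M / pe) := by positivity
      rw [← Finset.sum_mul, ← mul_assoc]
      linarith [add_mul (ℓ * ∑ j, C₁ j) (C₀ * c) (M / pe)]
  calc _ ≤ (bad₀.card : ℝ) + ∑ j, ((bad₁ j).card : ℝ) := by
        exact_mod_cast (Finset.card_union_le _ _).trans
          (Nat.add_le_add_left Finset.card_biUnion_le _)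
    _ ≤ η / (m + 1) / p ^ κ * 2 ^ N + ∑ _j : Fin m, η / (m + 1) / p ^ κ * 2 ^ N :=
        add_le_add hbad₀ (Finset.sum_le_sum fun j _ => hbad₁ j)
    _ = η / p ^ κ * 2 ^ N := by
        rw [Finset.sum_const, Finset.card_univ, Fintype.card_fin, nsmul_eq_mul]
        field_simp
        ring

theorem InGamma.hasProtocol {ε : ℝ} (hε₁ : ε < 1) (r : ℕ) {k : ℕ} {q : ConjQuery ar k}
    (hq : q.InGamma ε r) : HasProtocol.{u} q ε r := by
  induction r generalizing k with
  | zero => exact hq.elim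
  | succ r ih =>
    cases r with
    | zero => exact InGammaOne.hasProtocol hε₁ hq
    | succ r =>
      obtain ⟨m, a, qs, q₀, hqs, hq₀, hsub⟩ := hq
      exact HasProtocol.substitution (Nat.le_add_left 1 r) (fun j => (hqs j).1)
        (fun j => ih (hqs j).2) (InGammaOne.hasProtocol hε₁ hq₀) hsub

end ConjQuery

theorem mainTheorem9 {σ : Type*} {ar : σ → ℕ} {k : ℕ} (q : ConjQuery ar k)
    (ε : ℝ) (hε₀ : 0 ≤ ε) (hε₁ : ε < 1) (r : ℕ) (hq : q.InGamma ε r)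
    (η : ℝ) (hη : 0 < η) (κ : ℕ) :
    ∃ C : ℝ, 0 < C ∧
      ∀ (p n : ℕ) (M : ℝ), 1 ≤ p → 2 ≤ n →
        (p : ℝ) ^ (1 - ε) * Real.logb 2 p * Real.logb 2 n ≤ M →
        ∀ (W : Type*) [Fintype W],
          ∃ A : RandomizedMPCAlgorithm ar W n p k,
            ∀ I : Database ar n, I.IsMatching → (∀ S, I.relSize S ≤ M) →
              ∀ loc : (S : σ) → (Fin (ar S) → Fin n) → W,
                A.failureProb (I.fragment loc) r (C * (M / (p : ℝ) ^ (1 - ε))) (q.eval I)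
                  ≤ η / (p : ℝ) ^ κ := by
  classical
  obtain ⟨C, hC, H⟩ := ConjQuery.InGamma.hasProtocol hε₁ r hq η hη κ
  refine ⟨C, hC, fun p n M hp hn hM W _ => ?_⟩
  obtain ⟨N, G⟩ := H p n M hp hn hM W
  obtain ⟨A, own, -, hA⟩ := G N le_rfl
  refine ⟨⟨N, A⟩, fun I hI hsize loc => ?_⟩
  rw [RandomizedMPCAlgorithm.failureProb, div_le_iff₀ (by positivity)]
  obtain ⟨bad, hbad, hgood⟩ := hA I hI hsize
  refine le_trans (Nat.cast_le.2 (Finset.card_le_card fun ω hω => ?_)) hbad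
  by_contra h
  exact (Finset.mem_filter.1 hω).2 (hgood ω h loc)
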